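/- Let $H$ be a complex Hilbert space. A state is a positive operator $\rho$ on $H$ with $\operatorname{tr}\rho=1$; all suprema and infima over $\rho$ below run over all states. For discrete probability distributions $p,q$ put $D_1(p,q)=\frac12\sum_j|p_j-q_j|$, $F(p,q)=\sum_j\sqrt{p_j}\sqrt{q_j}$, $D_F(p,q)=1-F(p,q)^2$, $D_\infty(p,q)=\sup_j|p_j-q_j|$; for states $\rho,\sigma$ put $D_1(\rho,\sigma)=\frac12\operatorname{tr}|\rho-\sigma|$ and $F(\rho,\sigma)=\operatorname{tr}\sqrt{\rho^{1/2}\sigma\rho^{1/2}}$. (a) Let $A$ and $B$ be (bounded or unbounded) self-adjoint operators on $H$ with purely discrete spectra, that is, the eigenvectors of each span a dense subspace of $H$, and let $P^A_i$, $P^B_j$ be the orthogonal projections onto their eigenspaces. Put $\mathcal E^A(\rho)=\sum_iP^A_i\rho P^A_i$, $p^B_\rho(j)=\operatorname{tr}[P^B_j\rho]$ and $q^{A\to B}_\rho(j)=\operatorname{tr}[P^B_j\,\mathcal E^A(\rho)]$, and define $$\mathcal Q_\alpha(A\to B)=\sup_\rho D_\alpha\big(q^{A\to B}_\rho,p^B_\rho\big)\quad(\alpha\in\{1,F,\infty\}),$$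 $$D_1^{\max}(A)=\sup_\rho D_1(\mathcal E^A(\rho),\rho),\qquad D_F^{\max}(A)=1-\Big[\inf_\rho F(\mathcal E^A(\rho),\rho)\Big]^2 .$$ Then $\mathcal Q_1(A\to B)\le D_1^{\max}(A)$, $\mathcal Q_\infty(A\to B)\le D_1^{\max}(A)$ and $\mathcal Q_F(A\to B)\le D_F^{\max}(A)$. (b) Let $\mathcal A=\{A_i\}$ and $\mathcal B=\{B_j\}$ be discrete positive operator valued measures on $H$ ($0\le A_i\le\mathbb I$, $\sum_iA_i=\mathbb I$ strongly, and likewise for $\mathcal B$), and let $\Phi^{\mathcal A}$, $\Phi^{\mathcal B}$ be instruments implementing them: $\Phi^{\mathcal A}$ is a family of completely positive linear maps $\Phi^{\mathcal A}_i$ on the trace-class operators with $\operatorname{tr}[\Phi^{\mathcal A}_i(\rho)]=\operatorname{tr}[\rho A_i]$ for every state $\rho$, with associated channel $\Phi^{\mathcal A}(\rho)=\sum_i\Phi^{\mathcal A}_i(\rho)$, and likewise for $\Phi^{\mathcal B}$. Put $p_\rho(j)=\operatorname{tr}[\rho B_j]$, $q_\rho(j)=\operatorname{tr}[\Phi^{\mathcal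 A}(\rho)B_j]$, and $$\mathcal Q_\alpha(\Phi^{\mathcal A}\to\Phi^{\mathcal B})=\sup_\rho D_\alpha(q_\rho,p_\rho)\quad(\alpha\in\{1,F,\infty\}),$$ $$D_1^{\max}(\Phi^{\mathcal A})=\sup_\rho D_1(\Phi^{\mathcal A}(\rho),\rho),\qquad D_F^{\max}(\Phi^{\mathcal A})=\sup_\rho\big[1-F(\Phi^{\mathcal A}(\rho),\rho)^2\big].$$ Then $\mathcal Q_1(\Phi^{\mathcal A}\to\Phi^{\mathcal B})\le D_1^{\max}(\Phi^{\mathcal A})$, $\mathcal Q_\infty(\Phi^{\mathcal A}\to\Phi^{\mathcal B})\le D_1^{\max}(\Phi^{\mathcal A})$ and $\mathcal Q_F(\Phi^{\mathcal A}\to\Phi^{\mathcal B})\le D_F^{\max}(\Phi^{\mathcal A})$. -/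

import Mathlib

open scoped ENNReal InnerProductSpace ComplexOrder

namespace QMeas

noncomputable section

/-! ### Distances between discrete probability distributions

Distances take values in `[0, ∞]`, so that sums and suprema are always meaningful. For
probability distributions the fidelity is at most `1`, hence the subtraction in `distF` is the
usual one. -/

/-- Variational distance `(1/2) ∑ i, |p i - q i|`. -/
def dist1 {ι : Type*} (p q : ι → ℝ) : ℝ≥0∞ :=
  (∑' i, ENNReal.ofReal |p i - q i|) / 2

/-- Classical fidelity `∑ i, √(p i) √(q i)`. -/
def classicalFidelity {ι : Type*} (p q : ι → ℝ) : ℝ≥0∞ :=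
  ∑' i, ENNReal.ofReal (√(p i) * √(q i))

/-- Fidelity-based distance `1 - F(p, q)²`. -/
def distF {ι : Type*} (p q : ι → ℝ) : ℝ≥0∞ :=
  1 - classicalFidelity p q ^ 2

/-- Chebyshev distance `sup i, |p i - q i|`. -/
def distInf {ι : Type*} (p q : ι → ℝ) : ℝ≥0∞ :=
  ⨆ i, ENNReal.ofReal |p i - q i|

section Hilbert

variable {H : Type*} [NormedAddCommGroup H] [InnerProductSpace ℂ H] [CompleteSpace H]

/-! ### Trace, trace-class operators, quantum states -/

variable (H) in
/-- The index set of a chosen orthonormal basis of `H`. -/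
def basisIndex : Set H := (exists_hilbertBasis ℂ H).choose

variable (H) in
/-- A chosen orthonormal basis of `H`; the traces below do not depend on the choice. -/
def basis : HilbertBasis (basisIndex H) ℂ H := (exists_hilbertBasis ℂ H).choose_spec.choose

/-- The trace, in `[0, ∞]`, of a positive bounded operator. -/
def posTrace (T : H →L[ℂ] H) : ℝ≥0∞ :=
  ∑' i, ENNReal.ofReal (⟪basis H i, T (basis H i)⟫_ℂ).re

/-- The trace of a trace-class operator. -/
def trace (T : H →L[ℂ] H) : ℂ := ∑' i, ⟪basis H i, T (basis H i)⟫_ℂ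

/-- `tr |T|` with `|T| = √(T† T)`. -/
def traceNorm (T : H →L[ℂ] H) : ℝ≥0∞ := posTrace (CFC.abs T)

variable (H) in
/-- The space of trace-class operators: the linear span of the positive operators of finite
trace. -/
def traceClass : Submodule ℂ (H →L[ℂ] H) :=
  Submodule.span ℂ {T | 0 ≤ T ∧ posTrace T < ∞}

variable (H) in
/-- Quantum states: positive operators of trace one. -/
structure State where
  op : H →L[ℂ] H
  nonneg : 0 ≤ op
  trace_eq_one : posTrace op = 1

/-- A state as a trace-class operator. -/
def State.toTraceClass (ρ : State H) : traceClass H :=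
  ⟨ρ.op, Submodule.subset_span ⟨ρ.nonneg, by rw [ρ.trace_eq_one]; exact ENNReal.one_lt_top⟩⟩

/-- Trace distance `(1/2) tr |ρ - σ|`. -/
def traceDist (ρ σ : H →L[ℂ] H) : ℝ≥0∞ := traceNorm (ρ - σ) / 2

/-- Quantum fidelity `tr √(ρ^{1/2} σ ρ^{1/2})`. -/
def fidelity (ρ σ : H →L[ℂ] H) : ℝ≥0∞ :=
  posTrace (CFC.sqrt (CFC.sqrt ρ * σ * CFC.sqrt ρ))

/-! ### Observables with purely discrete spectrum -/

/-- The eigenspace `{x ∈ dom A | A x = a x}` of a (possibly unbounded) operator `A`. -/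
def eigenspace (A : H →ₗ.[ℂ] H) (a : ℝ) : Submodule ℂ H :=
  (LinearMap.ker (A.toFun - (a : ℂ) • A.domain.subtype)).map A.domain.subtype

/-- The set of (real) eigenvalues, i.e. of measurement outcomes. -/
def eigenvalues (A : H →ₗ.[ℂ] H) : Set ℝ := {a | eigenspace A a ≠ ⊥}

/-- An observable with purely discrete spectrum: a self-adjoint operator, bounded or not, whose
eigenvectors span a dense subspace. -/
structure IsDiscreteObservable (A : H →ₗ.[ℂ] H) : Prop where
  selfAdjoint : IsSelfAdjoint A
  purelyDiscrete : (⨆ a : ℝ, eigenspace A a).topologicalClosure = ⊤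

/-- The spectral projection `P_a` of `A`: the orthogonal projection onto the eigenspace of `a`.
Eigenspaces of a self-adjoint operator are closed, so taking the closure changes nothing. -/
def eigenProj (A : H →ₗ.[ℂ] H) (a : ℝ) : H →L[ℂ] H :=
  (eigenspace A a).topologicalClosure.starProjection

/-- The measurement channel `T ↦ ∑ a, P_a T P_a` of `A`, where `a` runs over the eigenvalues.
On states the series converges absolutely in trace norm, hence in operator norm. -/
def measChannel (A : H →ₗ.[ℂ] H) (T : H →L[ℂ] H) : H →L[ℂ] H :=
  ∑' a : eigenvalues A, eigenProj A a * T * eigenProj A a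

/-- Distribution of the outcomes of a measurement of `B` in the state `ρ`. -/
def outcomeProb (B : H →ₗ.[ℂ] H) (ρ : State H) (b : eigenvalues B) : ℝ :=
  (trace (eigenProj B b * ρ.op)).re

/-- Distribution of the outcomes of a measurement of `B` performed after a measurement of `A` on
the state `ρ`. -/
def seqProb (A B : H →ₗ.[ℂ] H) (ρ : State H) (b : eigenvalues B) : ℝ :=
  (trace (eigenProj B b * measChannel A ρ.op)).re

/-- `Q_1(A → B)`. -/
def Q1 (A B : H →ₗ.[ℂ] H) : ℝ≥0∞ := ⨆ ρ : State H, dist1 (seqProb A B ρ) (outcomeProb B ρ)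

/-- `Q_F(A → B)`. -/
def QF (A B : H →ₗ.[ℂ] H) : ℝ≥0∞ := ⨆ ρ : State H, distF (seqProb A B ρ) (outcomeProb B ρ)

/-- `Q_∞(A → B)`. -/
def QInf (A B : H →ₗ.[ℂ] H) : ℝ≥0∞ := ⨆ ρ : State H, distInf (seqProb A B ρ) (outcomeProb B ρ)

/-- The maximal disturbance of `A` in trace distance. -/
def D1max (A : H →ₗ.[ℂ] H) : ℝ≥0∞ := ⨆ ρ : State H, traceDist (measChannel A ρ.op) ρ.op

/-- The minimal fidelity of `A`. -/
def Fmin (A : H →ₗ.[ℂ] H) : ℝ≥0∞ := ⨅ ρ : State H, fidelity (measChannel A ρ.op) ρ.op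

/-- The maximal disturbance of `A` in terms of the fidelity. -/
def DFmax (A : H →ₗ.[ℂ] H) : ℝ≥0∞ := 1 - Fmin A ^ 2

/-! ### General measurements -/

variable (H) in
/-- A discrete positive operator valued measure with outcomes in `ι`; the sum `∑ i, A_i = 1`
converges strongly. -/
structure POVM (ι : Type*) where
  effect : ι → H →L[ℂ] H
  nonneg : ∀ i, 0 ≤ effect i
  le_one : ∀ i, effect i ≤ 1
  hasSum_one : ∀ x : H, HasSum (fun i => effect i x) x

/-- Positivity of a block operator `(T_{kl})` acting on `H ⊕ ⋯ ⊕ H`. -/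
def BlockPositive {n : ℕ} (T : Fin n → Fin n → H →L[ℂ] H) : Prop :=
  ∀ x : Fin n → H, 0 ≤ ∑ k, ∑ l, ⟪x k, T k l (x l)⟫_ℂ

/-- Complete positivity of a linear map on the trace-class operators. -/
def IsCompletelyPositive (Φ : traceClass H →ₗ[ℂ] traceClass H) : Prop :=
  ∀ (n : ℕ) (T : Fin n → Fin n → traceClass H),
    BlockPositive (fun k l => (T k l : H →L[ℂ] H)) →
      BlockPositive (fun k l => (Φ (T k l) : H →L[ℂ] H))

/-- An instrument implementing the POVM `A`: completely positive maps `Φ_i` with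
`tr Φ_i(ρ) = tr (ρ A_i)` for all states `ρ`. -/
structure Instrument {ι : Type*} (A : POVM H ι) where
  map : ι → traceClass H →ₗ[ℂ] traceClass H
  completelyPositive : ∀ i, IsCompletelyPositive (map i)
  trace_map : ∀ (i : ι) (ρ : State H),
    trace (map i ρ.toTraceClass : H →L[ℂ] H) = trace (ρ.op * A.effect i)

namespace Instrument

variable {ι κ : Type*} {A : POVM H ι} {B : POVM H κ}

/-- The channel `Φ(ρ) = ∑ i, Φ_i(ρ)`. The series converges absolutely in trace norm, hence in
operator norm. -/
def channel (Φ : Instrument A) (ρ : State H) : H →L[ℂ] H :=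
  ∑' i, (Φ.map i ρ.toTraceClass : H →L[ℂ] H)

/-- Distribution of the outcomes of the instrument `Ψ` in the state `ρ`. -/
def outcomeProb (_Ψ : Instrument B) (ρ : State H) (j : κ) : ℝ :=
  (trace (ρ.op * B.effect j)).re

/-- Distribution of the outcomes of `Ψ` when it is applied after `Φ` to the state `ρ`. -/
def seqProb (Φ : Instrument A) (_Ψ : Instrument B) (ρ : State H) (j : κ) : ℝ :=
  (trace (Φ.channel ρ * B.effect j)).re

/-- `Q_1(Φ → Ψ)`. -/
def Q1 (Φ : Instrument A) (Ψ : Instrument B) : ℝ≥0∞ :=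
  ⨆ ρ : State H, dist1 (Φ.seqProb Ψ ρ) (Ψ.outcomeProb ρ)

/-- `Q_F(Φ → Ψ)`. -/
def QF (Φ : Instrument A) (Ψ : Instrument B) : ℝ≥0∞ :=
  ⨆ ρ : State H, distF (Φ.seqProb Ψ ρ) (Ψ.outcomeProb ρ)

/-- `Q_∞(Φ → Ψ)`. -/
def QInf (Φ : Instrument A) (Ψ : Instrument B) : ℝ≥0∞ :=
  ⨆ ρ : State H, distInf (Φ.seqProb Ψ ρ) (Ψ.outcomeProb ρ)

/-- The maximal disturbance of `Φ` in trace distance. -/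
def D1max (Φ : Instrument A) : ℝ≥0∞ := ⨆ ρ : State H, traceDist (Φ.channel ρ) ρ.op

/-- The maximal disturbance of `Φ` in the distance `1 - F²`. -/
def DFmax (Φ : Instrument A) : ℝ≥0∞ := ⨆ ρ : State H, (1 - fidelity (Φ.channel ρ) ρ.op ^ 2)

end Instrument

end Hilbert

end

end QMeas

namespace QMeas

section Trace

variable {H : Type*} [NormedAddCommGroup H] [InnerProductSpace ℂ H]

/-! ### Traces of positive operators -/

/-! Fix `ρ` and let `σ` be the state left by the first measurement. The two distributions to compare
are then those of one and the same POVM in `σ` and in `ρ`, so each bound is monotonicity of a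
distance under the map from a state to its outcome probabilities; taking suprema over `ρ` finishes.
That `σ` is a state (`exists_state_of_tsum`) rests on the operator norm being at most the trace.

For the trace distance, write `σ - ρ = M - N` with `M, N ≥ 0` and `tr M + tr N = tr |σ - ρ|`. The
`j`-th probabilities differ by at most the larger of `tr (M B_j)` and `tr (N B_j)`. Summing over `j`
gives the variational bound; `tr M = tr N` gives the Chebyshev bound.

For the fidelity, `tr √(σ^{1/2} ρ σ^{1/2}) = tr |T|` with `T = ρ^{1/2} σ^{1/2}`. Replace `|T|` by `W
T` for a contraction `W`, up to a small error, insert `∑ j, B_j = 1`, and apply Cauchy–Schwarz to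
each summand (`fidelity_le_classicalFidelity`). -/

lemma re_inner_nonneg {T : H →L[ℂ] H} (hT : 0 ≤ T) (x : H) : 0 ≤ (⟪x, T x⟫_ℂ).re :=
  ((ContinuousLinearMap.nonneg_iff_isPositive T).1 hT).re_inner_nonneg_right x

lemma nonneg_of_inner {T : H →L[ℂ] H} (hT : ∀ x, 0 ≤ ⟪x, T x⟫_ℂ) : 0 ≤ T := by
  rw [ContinuousLinearMap.nonneg_iff_isPositive, ContinuousLinearMap.isPositive_iff_complex]
  intro x
  have h := hT x
  have h' : ⟪T x, x⟫_ℂ = ⟪x, T x⟫_ℂ := by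
    rw [← inner_conj_symm]
    exact Complex.conj_eq_iff_im.2 (Complex.le_def.1 h).2.symm
  rw [h']
  exact ⟨Complex.conj_eq_iff_re.1 (Complex.conj_eq_iff_im.2 (Complex.le_def.1 h).2.symm),
    (Complex.le_def.1 h).1⟩

variable [CompleteSpace H]

lemma norm_basis (i : basisIndex H) : ‖basis H i‖ = 1 := (basis H).orthonormal.1 i

lemma tsum_ofReal_norm_inner_sq (x : H) :
    ∑' i, ENNReal.ofReal (‖⟪basis H i, x⟫_ℂ‖ ^ 2) = ENNReal.ofReal (‖x‖ ^ 2) := by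
  have h : HasSum (fun i => ‖⟪basis H i, x⟫_ℂ‖ ^ 2) (‖x‖ ^ 2) := by
    have h := (Complex.reCLM.hasSum ((basis H).hasSum_inner_mul_inner x x))
    convert h using 1
    · ext i
      simp only [Complex.reCLM_apply]
      rw [← inner_conj_symm x, mul_comm, Complex.mul_conj, Complex.normSq_eq_norm_sq,
        Complex.ofReal_re]
    · simp only [Complex.reCLM_apply]
      rw [inner_self_eq_norm_sq_to_K]
      norm_cast
  rw [← h.tsum_eq, ENNReal.ofReal_tsum_of_nonneg (fun _ => by positivity) h.summable]

lemma posTrace_star_mul_self (A : H →L[ℂ] H) :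
    posTrace (star A * A) = ∑' i, ENNReal.ofReal (‖A (basis H i)‖ ^ 2) := by
  refine tsum_congr fun i => ?_
  rw [mul_apply_eq_comp, ContinuousLinearMap.star_eq_adjoint,
    ContinuousLinearMap.adjoint_inner_right, inner_self_eq_norm_sq_to_K]
  norm_cast

/-- `tr A†A = tr AA†`. -/
lemma posTrace_star_mul_comm (A : H →L[ℂ] H) : posTrace (star A * A) = posTrace (A * star A) := by
  have h := posTrace_star_mul_self (star A)
  rw [star_star] at h
  rw [posTrace_star_mul_self, h]
  simp_rw [← tsum_ofReal_norm_inner_sq (A _), ← tsum_ofReal_norm_inner_sq (star A _)]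
  rw [ENNReal.tsum_comm]
  refine tsum_congr fun i => tsum_congr fun j => ?_
  rw [ContinuousLinearMap.star_eq_adjoint, ContinuousLinearMap.adjoint_inner_right,
    norm_inner_symm]

lemma posTrace_add {S T : H →L[ℂ] H} (hS : 0 ≤ S) (hT : 0 ≤ T) :
    posTrace (S + T) = posTrace S + posTrace T := by
  rw [posTrace, posTrace, posTrace, ← ENNReal.tsum_add]
  refine tsum_congr fun i => ?_
  rw [← ENNReal.ofReal_add (re_inner_nonneg hS _) (re_inner_nonneg hT _)]
  simp

/-! ### Square roots and finiteness of the trace -/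

lemma star_sqrt (T : H →L[ℂ] H) : star (CFC.sqrt T) = CFC.sqrt T :=
  (IsSelfAdjoint.of_nonneg (CFC.sqrt_nonneg T)).star_eq

lemma inner_sqrt_left (T : H →L[ℂ] H) (x y : H) :
    ⟪CFC.sqrt T x, y⟫_ℂ = ⟪x, CFC.sqrt T y⟫_ℂ := by
  rw [← ContinuousLinearMap.adjoint_inner_right, ← ContinuousLinearMap.star_eq_adjoint, star_sqrt]

lemma sqrt_sqrt_apply {T : H →L[ℂ] H} (hT : 0 ≤ T) (x : H) :
    CFC.sqrt T (CFC.sqrt T x) = T x := by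
  rw [← mul_apply_eq_comp, CFC.sqrt_mul_sqrt_self T hT]

lemma inner_apply_eq_sqrt {T : H →L[ℂ] H} (hT : 0 ≤ T) (x y : H) :
    ⟪x, T y⟫_ℂ = ⟪CFC.sqrt T x, CFC.sqrt T y⟫_ℂ := by
  rw [inner_sqrt_left, sqrt_sqrt_apply hT]

lemma re_inner_eq_norm_sqrt_sq {T : H →L[ℂ] H} (hT : 0 ≤ T) (x : H) :
    (⟪x, T x⟫_ℂ).re = ‖CFC.sqrt T x‖ ^ 2 := by
  rw [inner_apply_eq_sqrt hT, inner_self_eq_norm_sq_to_K]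
  norm_cast

lemma posTrace_eq_tsum_norm_sqrt {T : H →L[ℂ] H} (hT : 0 ≤ T) :
    posTrace T = ∑' i, ENNReal.ofReal (‖CFC.sqrt T (basis H i)‖ ^ 2) :=
  tsum_congr fun _ => by rw [re_inner_eq_norm_sqrt_sq hT]

lemma summable_norm_sqrt_sq {T : H →L[ℂ] H} (hT : 0 ≤ T) (hT' : posTrace T ≠ ∞) :
    Summable fun i => ‖CFC.sqrt T (basis H i)‖ ^ 2 := by
  rw [posTrace_eq_tsum_norm_sqrt hT] at hT'
  convert ENNReal.summable_toReal hT' using 2 with i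
  rw [ENNReal.toReal_ofReal (by positivity)]

/-- The trace of `T` is the squared Hilbert–Schmidt norm of `√T`, which dominates `‖√T‖ ^ 2` and
hence `‖T‖`. Thus finite total trace makes a series of positive operators converge in operator norm.
-/
lemma norm_le_posTrace {T : H →L[ℂ] H} (hT : 0 ≤ T) : ENNReal.ofReal ‖T‖ ≤ posTrace T := by
  by_cases hfin : posTrace T = ∞
  · simp [hfin]
  have hsum := summable_norm_sqrt_sq hT hfin
  have htr : posTrace T = ENNReal.ofReal (∑' i, ‖CFC.sqrt T (basis H i)‖ ^ 2) := by
    rw [posTrace_eq_tsum_norm_sqrt hT, ENNReal.ofReal_tsum_of_nonneg (fun _ => by positivity) hsum]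
  have hS : ‖CFC.sqrt T‖ ^ 2 ≤ ∑' i, ‖CFC.sqrt T (basis H i)‖ ^ 2 := by
    rw [← Real.le_sqrt (norm_nonneg _) (tsum_nonneg fun _ => by positivity)]
    refine ContinuousLinearMap.opNorm_le_bound _ (Real.sqrt_nonneg _) fun x => ?_
    rw [← Real.sqrt_sq (norm_nonneg x), ← Real.sqrt_mul (tsum_nonneg fun _ => by positivity)]
    refine Real.le_sqrt_of_sq_le ?_
    rw [← ENNReal.ofReal_le_ofReal_iff (mul_nonneg (tsum_nonneg fun _ => by positivity)
      (by positivity)), ← tsum_ofReal_norm_inner_sq, ← tsum_mul_right,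
      ENNReal.ofReal_tsum_of_nonneg (fun _ => by positivity) (hsum.mul_right _)]
    refine ENNReal.tsum_le_tsum fun i => ENNReal.ofReal_le_ofReal ?_
    rw [← inner_sqrt_left, ← mul_pow]
    exact pow_le_pow_left₀ (norm_nonneg _) (norm_inner_le_norm _ _) 2
  rw [htr]
  refine ENNReal.ofReal_le_ofReal (le_trans ?_ hS)
  calc ‖T‖ = ‖CFC.sqrt T * CFC.sqrt T‖ := by rw [CFC.sqrt_mul_sqrt_self T hT]
    _ ≤ ‖CFC.sqrt T‖ ^ 2 := by rw [sq]; exact norm_mul_le _ _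

/-- A family of positive operators whose traces are summable is summable, and the trace of the sum
is the sum of the traces. -/
lemma tsum_of_posTrace_ne_top {ι : Type*} {T : ι → H →L[ℂ] H} (hT : ∀ i, 0 ≤ T i)
    (hfin : ∑' i, posTrace (T i) ≠ ∞) :
    0 ≤ ∑' i, T i ∧ posTrace (∑' i, T i) = ∑' i, posTrace (T i) := by
  have hs : Summable T := by
    refine Summable.of_norm ?_
    have h : ∑' i, ENNReal.ofReal ‖T i‖ ≠ ∞ :=
      ne_top_of_le_ne_top hfin (ENNReal.tsum_le_tsum fun i => norm_le_posTrace (hT i))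
    convert ENNReal.summable_toReal h using 2 with i
    rw [ENNReal.toReal_ofReal (norm_nonneg _)]
  have hin : ∀ x, HasSum (fun i => ⟪x, T i x⟫_ℂ) ⟪x, (∑' i, T i) x⟫_ℂ := fun x =>
    ((innerSL ℂ x).comp (ContinuousLinearMap.apply ℂ H x)).hasSum hs.hasSum
  have hinre : ∀ x, HasSum (fun i => (⟪x, T i x⟫_ℂ).re) (⟪x, (∑' i, T i) x⟫_ℂ).re := fun x =>
    Complex.reCLM.hasSum (hin x)
  refine ⟨nonneg_of_inner fun x => ?_, ?_⟩
  · refine (hin x).nonneg fun i => ?_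
    exact ((ContinuousLinearMap.nonneg_iff_isPositive (T i)).1 (hT i)).inner_nonneg_right x
  · simp_rw [posTrace]
    rw [ENNReal.tsum_comm]
    refine tsum_congr fun k => ?_
    rw [← (hinre _).tsum_eq, ENNReal.ofReal_tsum_of_nonneg (fun i => re_inner_nonneg (hT i) _)
      (hinre _).summable]

lemma summable_of_mem_traceClass {T : H →L[ℂ] H} (hT : T ∈ traceClass H) :
    Summable fun i => ⟪basis H i, T (basis H i)⟫_ℂ := by
  induction hT using Submodule.span_induction with
  | mem T h =>
    refine Summable.of_norm ?_
    convert summable_norm_sqrt_sq h.1 h.2.ne using 2 with i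
    rw [inner_apply_eq_sqrt h.1, inner_self_eq_norm_sq_to_K]
    simp
  | zero => simp
  | add S T _ _ hS hT => simpa [inner_add_right] using hS.add hT
  | smul c T _ hT => simpa [inner_smul_right] using hT.mul_left c

lemma posTrace_eq_ofReal_trace {T : H →L[ℂ] H} (hT : 0 ≤ T) (hT' : T ∈ traceClass H) :
    posTrace T = ENNReal.ofReal (trace T).re := by
  have hs := summable_of_mem_traceClass hT'
  rw [trace, Complex.re_tsum hs, ENNReal.ofReal_tsum_of_nonneg
    (fun i => re_inner_nonneg hT _) (Complex.reCLM.summable hs)]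
  rfl

/-- `tr X†Y = tr YX†` for Hilbert–Schmidt operators. -/
lemma tsum_inner_comm {X Y : H →L[ℂ] H} (hX : Summable fun i => ‖X (basis H i)‖ ^ 2)
    (hY : Summable fun i => ‖Y (basis H i)‖ ^ 2) :
    ∑' i, ⟪X (basis H i), Y (basis H i)⟫_ℂ =
      ∑' i, ⟪star Y (basis H i), star X (basis H i)⟫_ℂ := by
  have hsq : ∀ {Z : H →L[ℂ] H}, (Summable fun i => ‖Z (basis H i)‖ ^ 2) →
      Summable fun p : basisIndex H × basisIndex H => ‖⟪basis H p.2, Z (basis H p.1)⟫_ℂ‖ ^ 2 := by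
    intro Z hZ
    have h : ∑' p : basisIndex H × basisIndex H,
        ENNReal.ofReal (‖⟪basis H p.2, Z (basis H p.1)⟫_ℂ‖ ^ 2) ≠ ∞ := by
      rw [ENNReal.tsum_prod']
      simp_rw [tsum_ofReal_norm_inner_sq]
      rw [← ENNReal.ofReal_tsum_of_nonneg (fun _ => by positivity) hZ]
      exact ENNReal.ofReal_ne_top
    convert ENNReal.summable_toReal h using 2 with p
    rw [ENNReal.toReal_ofReal (by positivity)]
  have hs : Summable fun p : basisIndex H × basisIndex H =>
      ⟪X (basis H p.1), basis H p.2⟫_ℂ * ⟪basis H p.2, Y (basis H p.1)⟫_ℂ := by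
    -- Absolute summability over pairs, from `|xy| ≤ x² + y²`, permits exchanging the two sums.
    refine Summable.of_norm_bounded ((hsq hX).add (hsq hY)) fun p => ?_
    rw [norm_mul, norm_inner_symm]
    nlinarith [sq_nonneg (‖⟪basis H p.2, X (basis H p.1)⟫_ℂ‖ - ‖⟪basis H p.2, Y (basis H p.1)⟫_ℂ‖),
      sq_nonneg ‖⟪basis H p.2, X (basis H p.1)⟫_ℂ‖, sq_nonneg ‖⟪basis H p.2, Y (basis H p.1)⟫_ℂ‖]
  have h := Summable.tsum_comm (f := fun i k =>
    ⟪X (basis H i), basis H k⟫_ℂ * ⟪basis H k, Y (basis H i)⟫_ℂ) hs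
  simp_rw [(basis H).tsum_inner_mul_inner] at h
  rw [← h]
  refine tsum_congr fun k => ?_
  rw [← (basis H).tsum_inner_mul_inner]
  refine tsum_congr fun i => ?_
  rw [ContinuousLinearMap.star_eq_adjoint, ContinuousLinearMap.star_eq_adjoint,
    ContinuousLinearMap.adjoint_inner_left, ContinuousLinearMap.adjoint_inner_right, mul_comm]

end Trace
section Born

variable {H : Type*} [NormedAddCommGroup H] [InnerProductSpace ℂ H] [CompleteSpace H]

/-! ### Outcome probabilities -/

/-- The probability `tr (E^{1/2} ρ E^{1/2})` of the effect `E` in the state `ρ`. -/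
noncomputable def bornProb (ρ E : H →L[ℂ] H) : ℝ≥0∞ := posTrace (CFC.sqrt E * ρ * CFC.sqrt E)

variable {ρ E : H →L[ℂ] H}

/-- Cyclicity `tr AA† = tr A†A` for `A = E^{1/2} ρ^{1/2}`; this form is additive in `E` along each
vector `ρ^{1/2} e_i`. -/
lemma bornProb_eq_tsum (hρ : 0 ≤ ρ) :
    bornProb ρ E = ∑' i, ENNReal.ofReal (‖CFC.sqrt E (CFC.sqrt ρ (basis H i))‖ ^ 2) := by
  have h : CFC.sqrt E * ρ * CFC.sqrt E =
      (CFC.sqrt E * CFC.sqrt ρ) * star (CFC.sqrt E * CFC.sqrt ρ) := by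
    rw [star_mul, star_sqrt, star_sqrt, mul_assoc (CFC.sqrt E) (CFC.sqrt ρ),
      ← mul_assoc (CFC.sqrt ρ) (CFC.sqrt ρ), CFC.sqrt_mul_sqrt_self ρ hρ, mul_assoc]
  rw [bornProb, h, ← posTrace_star_mul_comm, posTrace_star_mul_self]
  rfl

lemma summable_norm_apply_sq {X : H →L[ℂ] H} (hX : Summable fun i => ‖X (basis H i)‖ ^ 2)
    (A : H →L[ℂ] H) : Summable fun i => ‖A (X (basis H i))‖ ^ 2 := by
  refine Summable.of_nonneg_of_le (fun _ => by positivity) (fun i => ?_) (hX.mul_left (‖A‖ ^ 2))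
  rw [← mul_pow]
  exact pow_le_pow_left₀ (norm_nonneg _) (A.le_opNorm _) 2

lemma bornProb_eq_ofReal (hρ : 0 ≤ ρ) (hρ' : posTrace ρ ≠ ∞) :
    bornProb ρ E = ENNReal.ofReal (∑' i, ‖CFC.sqrt E (CFC.sqrt ρ (basis H i))‖ ^ 2) := by
  rw [bornProb_eq_tsum hρ, ENNReal.ofReal_tsum_of_nonneg (fun _ => by positivity)
    (summable_norm_apply_sq (summable_norm_sqrt_sq hρ hρ') _)]

lemma bornProb_ne_top (hρ : 0 ≤ ρ) (hρ' : posTrace ρ ≠ ∞) : bornProb ρ E ≠ ∞ := by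
  rw [bornProb_eq_ofReal hρ hρ']
  exact ENNReal.ofReal_ne_top

/-- Factor `ρE` as `ρ^{1/2} · (ρ^{1/2} E)`, a product of Hilbert–Schmidt operators, and use
cyclicity to reach the manifestly nonnegative sum of `‖E^{1/2} ρ^{1/2} e_i‖ ^ 2`. -/
lemma re_trace_mul (hρ : 0 ≤ ρ) (hρ' : posTrace ρ ≠ ∞) (hE : 0 ≤ E) :
    (trace (ρ * E)).re = (bornProb ρ E).toReal := by
  have hX := summable_norm_sqrt_sq hρ hρ'
  have hstar : star (CFC.sqrt ρ * E) = E * CFC.sqrt ρ := by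
    rw [star_mul, star_sqrt, (IsSelfAdjoint.of_nonneg hE).star_eq]
  have hY : Summable fun i => ‖(CFC.sqrt ρ * E) (basis H i)‖ ^ 2 := by
    have h : ∑' i, ENNReal.ofReal (‖(CFC.sqrt ρ * E) (basis H i)‖ ^ 2) ≠ ∞ := by
      rw [← posTrace_star_mul_self, posTrace_star_mul_comm]
      have h2 := posTrace_star_mul_self (star (CFC.sqrt ρ * E))
      rw [star_star] at h2
      rw [h2, hstar]
      simp_rw [mul_apply_eq_comp]
      rw [← ENNReal.ofReal_tsum_of_nonneg (fun _ => by positivity) (summable_norm_apply_sq hX E)]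
      exact ENNReal.ofReal_ne_top
    convert ENNReal.summable_toReal h using 2 with i
    rw [ENNReal.toReal_ofReal (by positivity)]
  have h1 : trace (ρ * E) = ∑' i, ⟪CFC.sqrt ρ (basis H i), (CFC.sqrt ρ * E) (basis H i)⟫_ℂ :=
    tsum_congr fun i => by
      rw [mul_apply_eq_comp, mul_apply_eq_comp, inner_apply_eq_sqrt hρ]
  have h2 : ∀ i, ⟪star (CFC.sqrt ρ * E) (basis H i), star (CFC.sqrt ρ) (basis H i)⟫_ℂ =
      ((‖CFC.sqrt E (CFC.sqrt ρ (basis H i))‖ ^ 2 : ℝ) : ℂ) := fun i => by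
    rw [hstar, star_sqrt, mul_apply_eq_comp, ← sqrt_sqrt_apply hE, inner_sqrt_left,
      inner_self_eq_norm_sq_to_K]
    norm_cast
  rw [h1, tsum_inner_comm hX hY]
  simp_rw [h2]
  rw [← Complex.ofReal_tsum, Complex.ofReal_re, bornProb_eq_ofReal hρ hρ',
    ENNReal.toReal_ofReal (tsum_nonneg fun _ => by positivity)]

/-- The diagonal entries of `Eρ` and `ρE = (Eρ)†` are complex conjugates, so no cyclicity is needed.
-/
lemma re_trace_mul_comm (hρ : 0 ≤ ρ) (hE : 0 ≤ E) :
    (trace (E * ρ)).re = (trace (ρ * E)).re := by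
  have h : trace (E * ρ) = star (trace (ρ * E)) := by
    rw [trace, trace, tsum_star]
    refine tsum_congr fun i => ?_
    have hE' := (IsSelfAdjoint.of_nonneg hE).star_eq
    have hρ' := (IsSelfAdjoint.of_nonneg hρ).star_eq
    rw [mul_apply_eq_comp, mul_apply_eq_comp, ← hE', ContinuousLinearMap.star_eq_adjoint,
      ContinuousLinearMap.adjoint_inner_right, ← ContinuousLinearMap.star_eq_adjoint, hE']
    conv_lhs => rw [← hρ', ContinuousLinearMap.star_eq_adjoint,
      ContinuousLinearMap.adjoint_inner_right, ← inner_conj_symm]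
    rfl
  rw [h]
  simp

lemma bornProb_add {σ : H →L[ℂ] H} (hσ : 0 ≤ σ) (hρ : 0 ≤ ρ) :
    bornProb (σ + ρ) E = bornProb σ E + bornProb ρ E := by
  have h : ∀ τ : H →L[ℂ] H, 0 ≤ τ → 0 ≤ CFC.sqrt E * τ * CFC.sqrt E := fun τ hτ => by
    have := star_left_conjugate_nonneg hτ (CFC.sqrt E)
    rwa [star_sqrt] at this
  rw [bornProb, mul_add, add_mul, posTrace_add (h _ hσ) (h _ hρ)]
  rfl

variable {κ : Type*}

/-- The probabilities of the outcomes of a POVM add up to the trace. -/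
lemma POVM.tsum_bornProb (B : POVM H κ) (hρ : 0 ≤ ρ) :
    ∑' j, bornProb ρ (B.effect j) = posTrace ρ := by
  simp_rw [bornProb_eq_tsum hρ]
  rw [ENNReal.tsum_comm, posTrace_eq_tsum_norm_sqrt hρ]
  refine tsum_congr fun i => ?_
  set x := CFC.sqrt ρ (basis H i)
  simp_rw [← re_inner_eq_norm_sqrt_sq (B.nonneg _)]
  have h : HasSum (fun j => (⟪x, B.effect j x⟫_ℂ).re) (⟪x, x⟫_ℂ).re :=
    Complex.reCLM.hasSum ((innerSL ℂ x).hasSum (B.hasSum_one x))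
  rw [← ENNReal.ofReal_tsum_of_nonneg (fun j => re_inner_nonneg (B.nonneg j) x) h.summable,
    h.tsum_eq, inner_self_eq_norm_sq_to_K]
  norm_cast

lemma POVM.bornProb_le (B : POVM H κ) (hρ : 0 ≤ ρ) (j : κ) :
    bornProb ρ (B.effect j) ≤ posTrace ρ :=
  B.tsum_bornProb hρ ▸ ENNReal.le_tsum j

/-! ### Trace distance -/

lemma ofReal_abs_sub_le_max {a b m n : ℝ≥0∞} (ha : a ≠ ∞) (hb : b ≠ ∞) (hm : m ≠ ∞) (hn : n ≠ ∞)
    (h : a + n = b + m) : ENNReal.ofReal |a.toReal - b.toReal| ≤ max m n := by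
  lift a to NNReal using ha
  lift b to NNReal using hb
  lift m to NNReal using hm
  lift n to NNReal using hn
  have h' : (a : ℝ) + n = b + m := by exact_mod_cast h
  rw [← ENNReal.coe_max, ← ENNReal.ofReal_coe_nnreal (p := max m n)]
  refine ENNReal.ofReal_le_ofReal ?_
  simp only [ENNReal.coe_toReal, NNReal.coe_max]
  rcases le_total (a : ℝ) b with hab | hab
  · rw [abs_of_nonpos (by linarith)]
    exact le_max_of_le_right (by linarith [m.2])
  · rw [abs_of_nonneg (by linarith)]
    exact le_max_of_le_left (by linarith [n.2])

lemma State.posTrace_ne_top (ρ : State H) : posTrace ρ.op ≠ ∞ := by simp [ρ.trace_eq_one]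

/-- The Jordan decomposition of the difference of two states. -/
lemma exists_jordan_decomposition (σ ρ : State H) :
    ∃ M N : H →L[ℂ] H, 0 ≤ M ∧ 0 ≤ N ∧ σ.op + N = ρ.op + M ∧
      posTrace M + posTrace N = traceNorm (σ.op - ρ.op) := by
  have hsa : IsSelfAdjoint (σ.op - ρ.op) :=
    (IsSelfAdjoint.of_nonneg σ.nonneg).sub (IsSelfAdjoint.of_nonneg ρ.nonneg)
  have hpos : 0 ≤ (σ.op - ρ.op)⁺ := CFC.posPart_nonneg _
  have hneg : 0 ≤ (σ.op - ρ.op)⁻ := CFC.negPart_nonneg _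
  have habs : CFC.abs (σ.op - ρ.op) = (σ.op - ρ.op)⁺ + (σ.op - ρ.op)⁻ :=
    (CFC.posPart_add_negPart (σ.op - ρ.op) hsa).symm
  have hsub := CFC.posPart_sub_negPart (σ.op - ρ.op) hsa
  rw [traceNorm, habs]
  generalize (σ.op - ρ.op)⁺ = M at *
  generalize (σ.op - ρ.op)⁻ = N at *
  refine ⟨M, N, hpos, hneg, ?_, (posTrace_add hpos hneg).symm⟩
  rw [sub_eq_sub_iff_add_eq_add] at hsub
  rw [add_comm ρ.op, hsub]

/-- Evaluating `σ + N = ρ + M` on each effect avoids subtraction in `[0, ∞]`; the probabilities of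
`M` and `N` then sum to `tr M + tr N`. -/
lemma dist1_bornProb_le (B : POVM H κ) (σ ρ : State H) :
    dist1 (fun j => (bornProb σ.op (B.effect j)).toReal)
      (fun j => (bornProb ρ.op (B.effect j)).toReal) ≤ traceDist σ.op ρ.op := by
  obtain ⟨M, N, hM, hN, heq, htr⟩ := exists_jordan_decomposition σ ρ
  rw [dist1, traceDist]
  refine ENNReal.div_le_div_right ?_ 2
  rw [← htr]
  by_cases hM' : posTrace M = ∞
  · simp [hM']
  by_cases hN' : posTrace N = ∞
  · simp [hN']
  rw [← B.tsum_bornProb hM, ← B.tsum_bornProb hN, ← ENNReal.tsum_add]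
  refine ENNReal.tsum_le_tsum fun j => ?_
  refine (ofReal_abs_sub_le_max (bornProb_ne_top σ.nonneg σ.posTrace_ne_top)
    (bornProb_ne_top ρ.nonneg ρ.posTrace_ne_top) (bornProb_ne_top hM hM')
    (bornProb_ne_top hN hN') ?_).trans (max_le le_self_add le_add_self)
  rw [← bornProb_add σ.nonneg hN, heq, bornProb_add ρ.nonneg hM]

lemma distInf_bornProb_le (B : POVM H κ) (σ ρ : State H) :
    distInf (fun j => (bornProb σ.op (B.effect j)).toReal)
      (fun j => (bornProb ρ.op (B.effect j)).toReal) ≤ traceDist σ.op ρ.op := by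
  obtain ⟨M, N, hM, hN, heq, htr⟩ := exists_jordan_decomposition σ ρ
  have hMN : posTrace M = posTrace N := by
    have h := posTrace_add σ.nonneg hN
    rw [heq, posTrace_add ρ.nonneg hM, σ.trace_eq_one, ρ.trace_eq_one] at h
    exact (ENNReal.add_right_inj ENNReal.one_ne_top).1 h
  -- Equal traces turn `(tr M + tr N) / 2` into `tr M`, so no factor is lost.
  rw [distInf, traceDist, ← htr, ← hMN, ENNReal.add_div, ENNReal.add_halves]
  refine iSup_le fun j => ?_
  by_cases hM' : posTrace M = ∞
  · simp [hM']
  have hN' : posTrace N ≠ ∞ := hMN ▸ hM'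
  refine (ofReal_abs_sub_le_max (bornProb_ne_top σ.nonneg σ.posTrace_ne_top)
    (bornProb_ne_top ρ.nonneg ρ.posTrace_ne_top) (bornProb_ne_top hM hM')
    (bornProb_ne_top (E := B.effect j) hN hN') ?_).trans (max_le (B.bornProb_le hM j) ?_)
  · rw [← bornProb_add σ.nonneg hN, heq, bornProb_add ρ.nonneg hM]
  · rw [hMN]
    exact B.bornProb_le hN j

/-! ### Fidelity -/

/-- A regularised polar decomposition: `W = (|T| + ε)⁻¹ T†` satisfies `|T| - W T = ε (|T| + ε)⁻¹
|T|`, of norm at most `ε`. This avoids constructing a partial isometry. -/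
lemma exists_approx_polar (T : H →L[ℂ] H) {ε : ℝ} (hε : 0 < ε) :
    ∃ W : H →L[ℂ] H, ‖W‖ ≤ 1 ∧
      ∀ x, (⟪x, CFC.abs T x⟫_ℂ).re ≤ (⟪x, W (T x)⟫_ℂ).re + ε * ‖x‖ ^ 2 := by
  set a := CFC.abs T with ha
  have ha0 : 0 ≤ a := CFC.abs_nonneg T
  have hsa : IsSelfAdjoint a := IsSelfAdjoint.of_nonneg ha0
  have hspec : ∀ x ∈ spectrum ℝ a, 0 ≤ x := fun x hx => spectrum_nonneg_of_nonneg ha0 hx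
  set f : ℝ → ℝ := fun x => (x + ε)⁻¹
  have hf : ContinuousOn f (spectrum ℝ a) := by
    refine ContinuousOn.inv₀ (by fun_prop) fun x hx => ?_
    have := hspec x hx
    positivity
  set r := cfc f a
  have hr : star r = r := (cfc_predicate f a : IsSelfAdjoint r).star_eq
  have hcomm : r * a = a * r := by
    conv_lhs => rw [← cfc_id ℝ a hsa]
    conv_rhs => rw [← cfc_id ℝ a hsa]
    exact (cfc_commute_cfc f id a).eq
  have hinv : r * a + ε • r = 1 := by
    have h1 : r * a = cfc (fun x => f x * x) a := by
      rw [cfc_mul f (fun x => x) a hf (by fun_prop), cfc_id' ℝ a hsa]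
    have h2 : ε • r = cfc (fun x => ε * f x) a := (cfc_const_mul ε f a hf).symm
    rw [h1, h2, ← cfc_add a (fun x => f x * x) (fun x => ε * f x)
      (hf.mul continuousOn_id) (hf.const_smul ε), ← cfc_one ℝ a hsa]
    refine cfc_congr fun x hx => ?_
    have := hspec x hx
    simp only [f, Pi.one_apply]
    field_simp
  have hra : ‖r * a‖ ≤ 1 := by
    have h1 : r * a = cfc (fun x => f x * x) a := by
      rw [cfc_mul f (fun x => x) a hf (by fun_prop), cfc_id' ℝ a hsa]
    rw [h1]
    refine norm_cfc_le zero_le_one fun x hx => ?_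
    have := hspec x hx
    rw [Real.norm_of_nonneg (by positivity)]
    simp only [f]
    rw [inv_mul_le_iff₀ (by positivity)]
    linarith
  have haa : a * a = star T * T := CFC.abs_mul_abs T
  refine ⟨r * star T, ?_, fun x => ?_⟩
  -- `W W† = r T† T r = (r a)²` because `T† T = a²` and `r` commutes with `a`.
  · have h : ‖r * star T‖ * ‖r * star T‖ ≤ 1 := by
      rw [← CStarRing.norm_self_mul_star, star_mul, star_star, hr]
      calc ‖r * star T * (T * r)‖ = ‖(r * a) * (r * a)‖ := by
            rw [mul_assoc, ← mul_assoc (star T), ← haa, mul_assoc a a, ← hcomm, ← mul_assoc]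
        _ ≤ 1 := (norm_mul_le _ _).trans (mul_le_one₀ hra (norm_nonneg _) hra)
    nlinarith [norm_nonneg (r * star T)]
  · have hdec : a = r * star T * T + ε • (r * a) := by
      calc a = (r * a + ε • r) * a := by rw [hinv, one_mul]
        _ = _ := by rw [add_mul, mul_assoc, haa, smul_mul_assoc, mul_assoc]
    have hx : a x = (r * star T) (T x) + ε • (r * a) x := by
      conv_lhs => rw [hdec]
      rfl
    rw [hx, inner_add_right, Complex.add_re, inner_smul_right_eq_smul, Complex.smul_re, smul_eq_mul]
    refine add_le_add_right (mul_le_mul_of_nonneg_left ?_ hε.le) _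
    calc (⟪x, (r * a) x⟫_ℂ).re ≤ ‖x‖ * ‖(r * a) x‖ :=
          (Complex.re_le_norm _).trans (norm_inner_le_norm _ _)
      _ ≤ ‖x‖ * (1 * ‖x‖) := by
          gcongr
          exact (r * a).le_of_opNorm_le hra x
      _ = ‖x‖ ^ 2 := by ring

end Born
section Fidelity

variable {H : Type*} [NormedAddCommGroup H] [InnerProductSpace ℂ H] [CompleteSpace H]
variable {κ : Type*}

lemma re_inner_le_norm_sqrt {E : H →L[ℂ] H} (hE : 0 ≤ E) (u v : H) :
    (⟪u, E v⟫_ℂ).re ≤ ‖CFC.sqrt E u‖ * ‖CFC.sqrt E v‖ := by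
  rw [inner_apply_eq_sqrt hE]
  exact (Complex.re_le_norm _).trans (norm_inner_le_norm _ _)

/-- The Hilbert–Schmidt norm is invariant under adjoints, and in `(XW)† = W† X†` the contraction
acts last, so the bound holds term by term. -/
lemma tsum_norm_sq_comp_le (X : H →L[ℂ] H) {W : H →L[ℂ] H} (hW : ‖W‖ ≤ 1) :
    ∑' i, ENNReal.ofReal (‖X (W (basis H i))‖ ^ 2) ≤
      ∑' i, ENNReal.ofReal (‖X (basis H i)‖ ^ 2) := by
  have hstar : ∀ A : H →L[ℂ] H, ∑' i, ENNReal.ofReal (‖A (basis H i)‖ ^ 2) =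
      ∑' i, ENNReal.ofReal (‖star A (basis H i)‖ ^ 2) := fun A => by
    rw [← posTrace_star_mul_self, ← posTrace_star_mul_self, star_star, posTrace_star_mul_comm]
  have h := hstar (X * W)
  simp_rw [mul_apply_eq_comp] at h
  rw [h, hstar X]
  refine ENNReal.tsum_le_tsum fun i => ENNReal.ofReal_le_ofReal ?_
  refine pow_le_pow_left₀ (norm_nonneg _) ?_ 2
  rw [star_mul, mul_apply_eq_comp]
  simpa using (star W).le_of_opNorm_le ((norm_star W).trans_le hW) (star X (basis H i))

/-- A measurement does not decrease the fidelity of two states. -/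
lemma fidelity_le_classicalFidelity (B : POVM H κ) (σ ρ : State H) :
    fidelity σ.op ρ.op ≤ classicalFidelity (fun j => (bornProb σ.op (B.effect j)).toReal)
      (fun j => (bornProb ρ.op (B.effect j)).toReal) := by
  set R := CFC.sqrt ρ.op with hR
  set S := CFC.sqrt σ.op with hS
  have habs : CFC.sqrt (S * ρ.op * S) = CFC.abs (R * S) := by
    rw [CFC.abs, star_mul, hR, hS, star_sqrt, star_sqrt, mul_assoc (CFC.sqrt σ.op) (CFC.sqrt ρ.op),
      ← mul_assoc (CFC.sqrt ρ.op) (CFC.sqrt ρ.op), CFC.sqrt_mul_sqrt_self _ ρ.nonneg, mul_assoc]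
  have habs0 : 0 ≤ CFC.abs (R * S) := CFC.abs_nonneg _
  rw [fidelity, habs, posTrace, ENNReal.tsum_eq_iSup_sum]
  refine iSup_le fun s => ENNReal.le_of_forall_pos_le_add fun δ hδ _ => ?_
  -- Each vector of `s` costs an error `ε`, so the total stays below `δ`; the `+ 1` covers empty
  -- `s`.
  set ε : ℝ := δ / (s.card + 1) with hε
  have hε0 : 0 < ε := by positivity
  obtain ⟨W, hW, hle⟩ := exists_approx_polar (R * S) hε0
  have hpart : ∀ {τ V : H →L[ℂ] H}, 0 ≤ τ → posTrace τ ≠ ∞ → ‖V‖ ≤ 1 → ∀ j,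
      ∑ i ∈ s, ‖CFC.sqrt (B.effect j) (CFC.sqrt τ (V (basis H i)))‖ ^ 2 ≤
        (bornProb τ (B.effect j)).toReal := by
    intro τ V hτ hτ' hV j
    refine (ENNReal.ofReal_le_iff_le_toReal (bornProb_ne_top hτ hτ')).1 ?_
    rw [ENNReal.ofReal_sum_of_nonneg fun _ _ => by positivity, bornProb_eq_tsum hτ]
    exact (ENNReal.sum_le_tsum s).trans
      (tsum_norm_sq_comp_le (CFC.sqrt (B.effect j) * CFC.sqrt τ) hV)
  have hinner : ∀ i, ENNReal.ofReal (⟪basis H i, W ((R * S) (basis H i))⟫_ℂ).re ≤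
      ∑' j, ENNReal.ofReal (‖CFC.sqrt (B.effect j) (R (star W (basis H i)))‖ *
        ‖CFC.sqrt (B.effect j) (S (basis H i))‖) := by
    intro i
    have h1 : ⟪basis H i, W ((R * S) (basis H i))⟫_ℂ =
        ⟪R (star W (basis H i)), S (basis H i)⟫_ℂ := by
      rw [inner_sqrt_left, ContinuousLinearMap.star_eq_adjoint,
        ContinuousLinearMap.adjoint_inner_left, mul_apply_eq_comp]
    set u := R (star W (basis H i))
    set v := S (basis H i)
    have h2 : HasSum (fun j => (⟪u, B.effect j v⟫_ℂ).re) (⟪u, v⟫_ℂ).re :=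
      Complex.reCLM.hasSum ((innerSL ℂ u).hasSum (B.hasSum_one v))
    rw [h1]
    by_cases htop : ∑' j, ENNReal.ofReal (‖CFC.sqrt (B.effect j) u‖ *
        ‖CFC.sqrt (B.effect j) v‖) = ∞
    · rw [htop]
      exact le_top
    have h3 : Summable fun j => ‖CFC.sqrt (B.effect j) u‖ * ‖CFC.sqrt (B.effect j) v‖ := by
      convert ENNReal.summable_toReal htop using 2 with j
      rw [ENNReal.toReal_ofReal (by positivity)]
    rw [← h2.tsum_eq, ← ENNReal.ofReal_tsum_of_nonneg (fun _ => by positivity) h3]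
    exact ENNReal.ofReal_le_ofReal (h2.summable.tsum_le_tsum
      (fun j => re_inner_le_norm_sqrt (B.nonneg j) u v) h3)
  calc ∑ i ∈ s, ENNReal.ofReal (⟪basis H i, CFC.abs (R * S) (basis H i)⟫_ℂ).re
      ≤ ∑ i ∈ s, (ENNReal.ofReal (⟪basis H i, W ((R * S) (basis H i))⟫_ℂ).re +
          ENNReal.ofReal ε) := by
        refine Finset.sum_le_sum fun i _ => ?_
        refine (ENNReal.ofReal_le_ofReal (hle (basis H i))).trans ?_
        rw [norm_basis, one_pow, mul_one]
        exact ENNReal.ofReal_add_le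
    _ ≤ ∑ i ∈ s, (∑' j, ENNReal.ofReal (‖CFC.sqrt (B.effect j) (R (star W (basis H i)))‖ *
        ‖CFC.sqrt (B.effect j) (S (basis H i))‖)) + s.card * ENNReal.ofReal ε := by
        rw [Finset.sum_add_distrib, Finset.sum_const, nsmul_eq_mul]
        exact add_le_add_left (Finset.sum_le_sum fun i _ => hinner i) _
    _ ≤ _ := by
        refine add_le_add ?_ ?_
        · rw [← Summable.tsum_finsetSum fun _ _ => ENNReal.summable, classicalFidelity]
          refine ENNReal.tsum_le_tsum fun j => ?_
          rw [← ENNReal.ofReal_sum_of_nonneg fun _ _ => by positivity]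
          refine ENNReal.ofReal_le_ofReal ((Real.sum_mul_le_sqrt_mul_sqrt _ _ _).trans ?_)
          rw [mul_comm]
          refine mul_le_mul (Real.sqrt_le_sqrt ?_) (Real.sqrt_le_sqrt ?_) (by positivity)
            (by positivity)
          -- The contraction is moved entirely to the `ρ` side, leaving the identity on the `σ`
          -- side.
          · exact hpart σ.nonneg σ.posTrace_ne_top (V := 1) ContinuousLinearMap.norm_id_le j
          · exact hpart ρ.nonneg ρ.posTrace_ne_top (V := star W) ((norm_star W).trans_le hW) j
        · rw [← ENNReal.ofReal_natCast, ← ENNReal.ofReal_mul (by positivity),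
            ← ENNReal.ofReal_coe_nnreal]
          refine ENNReal.ofReal_le_ofReal ?_
          rw [hε, mul_div_assoc', div_le_iff₀ (by positivity)]
          nlinarith [δ.2]

lemma distF_bornProb_le (B : POVM H κ) (σ ρ : State H) :
    distF (fun j => (bornProb σ.op (B.effect j)).toReal)
      (fun j => (bornProb ρ.op (B.effect j)).toReal) ≤ 1 - fidelity σ.op ρ.op ^ 2 :=
  tsub_le_tsub_left (pow_le_pow_left₀ zero_le (fidelity_le_classicalFidelity B σ ρ) 2) 1

end Fidelity

section Observable

variable {H : Type*} [NormedAddCommGroup H] [InnerProductSpace ℂ H]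

/-! ### Observables with purely discrete spectrum -/

lemma mem_eigenspace {A : H →ₗ.[ℂ] H} {a : ℝ} {x : H} :
    x ∈ eigenspace A a ↔ ∃ y : A.domain, A y = (a : ℂ) • (y : H) ∧ (y : H) = x := by
  simp only [eigenspace, Submodule.mem_map, LinearMap.mem_ker, LinearMap.sub_apply, sub_eq_zero]
  rfl

variable [CompleteSpace H]

lemma eigenspace_isOrtho {A : H →ₗ.[ℂ] H} (hA : IsSelfAdjoint A) {a b : ℝ} (hab : a ≠ b) :
    eigenspace A a ⟂ eigenspace A b := by
  rw [Submodule.isOrtho_iff_inner_eq]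
  rintro _ hmx _ hmy
  obtain ⟨x, hx, rfl⟩ := mem_eigenspace.1 hmx
  obtain ⟨y, hy, rfl⟩ := mem_eigenspace.1 hmy
  have hadj := LinearPMap.adjoint_isFormalAdjoint hA.dense_domain
  rw [LinearPMap.isSelfAdjoint_def.1 hA] at hadj
  have h := hadj x y
  rw [hx, hy, inner_smul_left, inner_smul_right, Complex.conj_ofReal] at h
  have h' : ((a : ℂ) - b) * ⟪(x : H), (y : H)⟫_ℂ = 0 := by rw [sub_mul, h, sub_self]
  exact (mul_eq_zero.1 h').resolve_left (sub_ne_zero.2 (by exact_mod_cast hab))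

namespace IsDiscreteObservable

variable {A : H →ₗ.[ℂ] H}

lemma closure_isOrtho (hA : IsDiscreteObservable A) {a b : ℝ} (hab : a ≠ b) :
    (eigenspace A a).topologicalClosure ⟂ (eigenspace A b).topologicalClosure := by
  rw [Submodule.isOrtho_iff_le, Submodule.orthogonal_closure]
  exact Submodule.topologicalClosure_minimal _ (eigenspace_isOrtho hA.selfAdjoint hab)
    (Submodule.isClosed_orthogonal _)

lemma hasSum_eigenProj (hA : IsDiscreteObservable A) (x : H) :
    HasSum (fun a : eigenvalues A => eigenProj A a x) x := by
  let F : eigenvalues A → Submodule ℂ H := fun a => (eigenspace A (a : ℝ)).topologicalClosure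
  have hortho : OrthogonalFamily ℂ (fun a => F a) fun a => (F a).subtypeₗᵢ := by
    refine OrthogonalFamily.of_pairwise fun a b hab => ?_
    exact hA.closure_isOrtho fun h => hab (Subtype.ext h)
  have htotal : ⊤ ≤ (⨆ a, F a).topologicalClosure := by
    rw [← hA.purelyDiscrete]
    refine Submodule.topologicalClosure_mono (iSup_le fun a => ?_)
    -- Reals that are not eigenvalues contribute only the zero subspace.
    by_cases ha : eigenspace A a = ⊥
    · simp [ha]
    · exact (Submodule.le_topologicalClosure _).trans (le_iSup F ⟨a, ha⟩)
  have hF := IsHilbertSum.mkInternal F hortho htotal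
  have hsum := hF.hasSum_linearIsometryEquiv_symm (hF.linearIsometryEquiv x)
  rw [LinearIsometryEquiv.symm_apply_apply] at hsum
  set y := hF.linearIsometryEquiv x
  convert hsum using 1
  ext a
  -- Projecting the expansion of `x` isolates its `a`-th component, by orthogonality of the
  -- eigenspaces.
  have ha := (eigenProj A a).hasSum hsum
  refine ha.unique ?_
  convert hasSum_single a ?_ using 1
  · exact (Submodule.starProjection_eq_self_iff.2 (y a).2).symm
  · intro b hb
    refine (Submodule.starProjection_apply_eq_zero_iff _).2 ?_
    exact (hA.closure_isOrtho fun h => hb (Subtype.ext h)) (y b).2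

/-- The projection-valued measure of an observable with purely discrete spectrum. -/
noncomputable def toPOVM (hA : IsDiscreteObservable A) : POVM H (eigenvalues A) where
  effect a := eigenProj A a
  nonneg a := by
    rw [ContinuousLinearMap.nonneg_iff_isPositive]
    exact .of_isStarProjection isStarProjection_starProjection
  le_one a := (isStarProjection_starProjection (U := (eigenspace A (a : ℝ)).topologicalClosure)).le_one
  hasSum_one := hA.hasSum_eigenProj

end IsDiscreteObservable

/-! ### States after a measurement of an observable -/

lemma exists_state_of_tsum {ι : Type*} {T : ι → H →L[ℂ] H} (hT : ∀ i, 0 ≤ T i)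
    (h : ∑' i, posTrace (T i) = 1) : ∃ σ : State H, σ.op = ∑' i, T i := by
  obtain ⟨h0, h1⟩ := tsum_of_posTrace_ne_top hT (by simp [h])
  exact ⟨⟨_, h0, h1.trans h⟩, rfl⟩

lemma IsDiscreteObservable.exists_state_measChannel {A : H →ₗ.[ℂ] H} (hA : IsDiscreteObservable A)
    (ρ : State H) : ∃ σ : State H, σ.op = measChannel A ρ.op := by
  have hproj : ∀ a, IsStarProjection (eigenProj A a) := fun a => isStarProjection_starProjection
  refine exists_state_of_tsum (fun a => ?_) ?_
  · have h := star_left_conjugate_nonneg ρ.nonneg (eigenProj A a)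
    rwa [(hproj a).isSelfAdjoint.star_eq] at h
  · rw [← ρ.trace_eq_one, ← hA.toPOVM.tsum_bornProb ρ.nonneg]
    refine tsum_congr fun a => ?_
    -- A projection is its own square root, so `tr (P_a ρ P_a)` is the Born probability of `a`;
    -- these sum to one.
    have hsqrt : CFC.sqrt (eigenProj A a) = eigenProj A a :=
      CFC.sqrt_unique (hproj a).isIdempotentElem (hA.toPOVM.nonneg a)
    rw [bornProb]
    change _ = posTrace (CFC.sqrt (eigenProj A a) * ρ.op * CFC.sqrt (eigenProj A a))
    rw [hsqrt]

lemma IsDiscreteObservable.outcomeProb_eq {B : H →ₗ.[ℂ] H} (hB : IsDiscreteObservable B)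
    (ρ : State H) :
    outcomeProb B ρ = fun b => (bornProb ρ.op (hB.toPOVM.effect b)).toReal := by
  ext b
  rw [← re_trace_mul ρ.nonneg ρ.posTrace_ne_top (hB.toPOVM.nonneg b),
    ← re_trace_mul_comm ρ.nonneg (hB.toPOVM.nonneg b)]
  rfl

lemma IsDiscreteObservable.seqProb_eq {A B : H →ₗ.[ℂ] H} (hB : IsDiscreteObservable B)
    {ρ σ : State H} (hσ : σ.op = measChannel A ρ.op) :
    seqProb A B ρ = fun b => (bornProb σ.op (hB.toPOVM.effect b)).toReal := by
  rw [← hB.outcomeProb_eq]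
  ext b
  rw [seqProb, ← hσ, outcomeProb]

end Observable

namespace Instrument

variable {H : Type*} [NormedAddCommGroup H] [InnerProductSpace ℂ H] [CompleteSpace H]
variable {ι κ : Type*} {A : POVM H ι} {B : POVM H κ}

/-! ### General measurements -/

lemma map_nonneg (Φ : Instrument A) (i : ι) (ρ : State H) :
    0 ≤ (Φ.map i ρ.toTraceClass : H →L[ℂ] H) := by
  refine nonneg_of_inner fun x => ?_
  -- Blocks of size one: only ordinary positivity is needed.
  have h := Φ.completelyPositive i 1 (fun _ _ => ρ.toTraceClass) (fun y => ?_) fun _ => x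
  · simpa using h
  · simpa using! ((ContinuousLinearMap.nonneg_iff_isPositive ρ.op).1 ρ.nonneg).inner_nonneg_right
      (y 0)

/-- The trace condition identifies `tr Φ_i(ρ)` with the probability of outcome `i`, and these add up
to one. -/
lemma exists_state_channel (Φ : Instrument A) (ρ : State H) :
    ∃ σ : State H, σ.op = Φ.channel ρ := by
  refine exists_state_of_tsum (fun i => Φ.map_nonneg i ρ) ?_
  rw [← ρ.trace_eq_one, ← A.tsum_bornProb ρ.nonneg]
  refine tsum_congr fun i => ?_
  rw [posTrace_eq_ofReal_trace (Φ.map_nonneg i ρ) (Subtype.mem _), Φ.trace_map,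
    re_trace_mul ρ.nonneg ρ.posTrace_ne_top (A.nonneg i),
    ENNReal.ofReal_toReal (bornProb_ne_top ρ.nonneg ρ.posTrace_ne_top)]

lemma outcomeProb_eq (Ψ : Instrument B) (ρ : State H) :
    Ψ.outcomeProb ρ = fun j => (bornProb ρ.op (B.effect j)).toReal := by
  ext j
  exact re_trace_mul ρ.nonneg ρ.posTrace_ne_top (B.nonneg j)

lemma seqProb_eq (Φ : Instrument A) (Ψ : Instrument B) {ρ σ : State H}
    (hσ : σ.op = Φ.channel ρ) :
    Φ.seqProb Ψ ρ = fun j => (bornProb σ.op (B.effect j)).toReal := by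
  rw [← Ψ.outcomeProb_eq]
  ext j
  rw [seqProb, ← hσ, outcomeProb]

end Instrument

end QMeas

/-! ### The disturbance bounds -/

theorem lemma2 {H : Type*} [NormedAddCommGroup H] [InnerProductSpace ℂ H] [CompleteSpace H] :
    (∀ A B : H →ₗ.[ℂ] H, QMeas.IsDiscreteObservable A → QMeas.IsDiscreteObservable B →
      QMeas.Q1 A B ≤ QMeas.D1max A ∧
      QMeas.QInf A B ≤ QMeas.D1max A ∧
      QMeas.QF A B ≤ QMeas.DFmax A ∧
      QMeas.DFmax A = 1 - (⨅ ρ : QMeas.State H,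
        QMeas.fidelity (QMeas.measChannel A ρ.op) ρ.op) ^ 2) ∧
    (∀ {ι κ : Type*} (𝒜 : QMeas.POVM H ι) (ℬ : QMeas.POVM H κ)
      (Φ : QMeas.Instrument 𝒜) (Ψ : QMeas.Instrument ℬ),
      Φ.Q1 Ψ ≤ Φ.D1max ∧
      Φ.QInf Ψ ≤ Φ.D1max ∧
      Φ.QF Ψ ≤ Φ.DFmax) := by
  refine ⟨fun A B hA hB => ⟨?_, ?_, ?_, rfl⟩, fun 𝒜 ℬ Φ Ψ => ⟨?_, ?_, ?_⟩⟩
  · refine iSup_mono fun ρ => ?_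
    obtain ⟨σ, hσ⟩ := hA.exists_state_measChannel ρ
    rw [hB.outcomeProb_eq, hB.seqProb_eq hσ, ← hσ]
    exact QMeas.dist1_bornProb_le hB.toPOVM σ ρ
  · refine iSup_mono fun ρ => ?_
    obtain ⟨σ, hσ⟩ := hA.exists_state_measChannel ρ
    rw [hB.outcomeProb_eq, hB.seqProb_eq hσ, ← hσ]
    exact QMeas.distInf_bornProb_le hB.toPOVM σ ρ
  · refine iSup_le fun ρ => ?_
    obtain ⟨σ, hσ⟩ := hA.exists_state_measChannel ρ
    rw [hB.outcomeProb_eq, hB.seqProb_eq hσ]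
    -- Here the extremum sits inside the square: `1 - F²` for this `ρ` is at most `1 - (inf F)²`.
    refine (QMeas.distF_bornProb_le hB.toPOVM σ ρ).trans (tsub_le_tsub_left ?_ 1)
    rw [hσ]
    exact pow_le_pow_left₀ zero_le (iInf_le _ ρ) 2
  · refine iSup_mono fun ρ => ?_
    obtain ⟨σ, hσ⟩ := Φ.exists_state_channel ρ
    rw [Ψ.outcomeProb_eq, Φ.seqProb_eq Ψ hσ, ← hσ]
    exact QMeas.dist1_bornProb_le ℬ σ ρ
  · refine iSup_mono fun ρ => ?_
    obtain ⟨σ, hσ⟩ := Φ.exists_state_channel ρ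
    rw [Ψ.outcomeProb_eq, Φ.seqProb_eq Ψ hσ, ← hσ]
    exact QMeas.distInf_bornProb_le ℬ σ ρ
  · refine iSup_mono fun ρ => ?_
    obtain ⟨σ, hσ⟩ := Φ.exists_state_channel ρ
    rw [Ψ.outcomeProb_eq, Φ.seqProb_eq Ψ hσ, ← hσ]
    exact QMeas.distF_bornProb_le ℬ σ ρ
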